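/- Let $\mathcal D$ be an infinite alphabet whose letters are presented effectively, i.e. $\mathcal D$ comes with a primitive recursive numbering: an injection $\mathcal D\to\mathbb N$ whose image is primitive recursive. Consider the first-order formulas on words over $\mathcal D$, $$\varphi,\psi ::= \forall_x\,\varphi \mid \exists_x\,\varphi \mid \varphi\wedge\psi \mid \varphi\vee\psi \mid \neg\varphi \mid x=y \mid x<y \mid x=_L a \qquad (a\in\mathcal D).$$ Such a formula is evaluated on a finite (possibly empty) word $w\in\mathcal D^*$: variables range over the positions of $w$, $=$ and $<$ are equality and order of positions, and $x=_L a$ says that the letter of $w$ at position $x$ is $a$. Call $\varphi$ satisfiable if it holds in some word $w\in\mathcal D^*$ (for some assignment of positions of $w$ to the free variables of $\varphi$, if it has any). Then the emptiness (satisfiability) problem for first-order logic on words over $\mathcal D$ is decidable: there is an algorithm which, given a first-order formula $\varphi$ (under the standard numbering of formulas induced by the numbering of $\mathcal D$), decides whether $\varphi$ is satisfiable. -/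

import Mathlib

universe u

/-- First-order formulas on words over the alphabet `D`. Variables are named by natural numbers and
range over positions of the word; `letter x a` is the predicate "the letter at position `x`
is `a`". -/
inductive WordFormula (D : Type u) : Type u
  | all (x : ℕ) (φ : WordFormula D)
  | ex (x : ℕ) (φ : WordFormula D)
  | conj (φ ψ : WordFormula D)
  | disj (φ ψ : WordFormula D)
  | neg (φ : WordFormula D)
  | eqPos (x y : ℕ)
  | ltPos (x y : ℕ)
  | letter (x : ℕ) (a : D)

namespace WordFormula

variable {D : Type u}

/-- The free variables of a formula. -/
def freeVars : WordFormula D → Finset ℕ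
  | all x φ => φ.freeVars.erase x
  | ex x φ => φ.freeVars.erase x
  | conj φ ψ => φ.freeVars ∪ ψ.freeVars
  | disj φ ψ => φ.freeVars ∪ ψ.freeVars
  | neg φ => φ.freeVars
  | eqPos x y => {x, y}
  | ltPos x y => {x, y}
  | letter x _ => {x}

/-- `φ.Holds w v`: the formula `φ` is true in the word `w` under the assignment `v` of positions to
variables. Positions of `w` are the numbers `0, …, |w| - 1`, and quantifiers range over exactly
these. Only assignments that send the free variables of `φ` to positions of `w` are of interest. -/
def Holds (w : List D) : WordFormula D → (ℕ → ℕ) → Prop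
  | all x φ, v => ∀ i < w.length, φ.Holds w (Function.update v x i)
  | ex x φ, v => ∃ i < w.length, φ.Holds w (Function.update v x i)
  | conj φ ψ, v => φ.Holds w v ∧ ψ.Holds w v
  | disj φ ψ, v => φ.Holds w v ∨ ψ.Holds w v
  | neg φ, v => ¬ φ.Holds w v
  | eqPos x y, v => v x = v y
  | ltPos x y, v => v x < v y
  | letter x a, v => w[v x]? = some a

/-- `φ` is satisfiable (has nonempty semantics): some finite word, possibly the empty one, makes it
true, where free variables, if there are any, are assigned to positions of that word. For a formula
without free variables the assignment is irrelevant. -/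
def Satisfiable (φ : WordFormula D) : Prop :=
  ∃ (w : List D) (v : ℕ → ℕ), (∀ x ∈ φ.freeVars, v x < w.length) ∧ φ.Holds w v

/-! ### Formulas as inputs of algorithms

Formulas are numbered in the usual way, given a numbering of the letters. -/

/-- The number of a formula. -/
def toCode [Encodable D] : WordFormula D → ℕ
  | eqPos x y => 8 * Nat.pair x y
  | ltPos x y => 8 * Nat.pair x y + 1
  | letter x a => 8 * Nat.pair x (Encodable.encode a) + 2
  | neg φ => 8 * φ.toCode + 3
  | conj φ ψ => 8 * Nat.pair φ.toCode ψ.toCode + 4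
  | disj φ ψ => 8 * Nat.pair φ.toCode ψ.toCode + 5
  | all x φ => 8 * Nat.pair x φ.toCode + 6
  | ex x φ => 8 * Nat.pair x φ.toCode + 7

/-- The formula with a given number, if there is one. -/
def ofCode [Encodable D] (n : ℕ) : Option (WordFormula D) :=
  if n % 8 = 0 then some (eqPos (n / 8).unpair.1 (n / 8).unpair.2)
  else if n % 8 = 1 then some (ltPos (n / 8).unpair.1 (n / 8).unpair.2)
  else if n % 8 = 2 then (Encodable.decode (n / 8).unpair.2).map (letter (n / 8).unpair.1)
  else if n % 8 = 3 then (ofCode (n / 8)).map neg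
  else if n % 8 = 4 then
    (ofCode (n / 8).unpair.1).bind fun φ => (ofCode (n / 8).unpair.2).map (conj φ)
  else if n % 8 = 5 then
    (ofCode (n / 8).unpair.1).bind fun φ => (ofCode (n / 8).unpair.2).map (disj φ)
  else if n % 8 = 6 then (ofCode (n / 8).unpair.2).map (all (n / 8).unpair.1)
  else (ofCode (n / 8).unpair.2).map (ex (n / 8).unpair.1)
termination_by n
decreasing_by
  all_goals
    have h1 := Nat.unpair_left_le (n / 8)
    have h2 := Nat.unpair_right_le (n / 8)
    omega

theorem ofCode_toCode [Encodable D] (φ : WordFormula D) : ofCode φ.toCode = some φ := by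
  induction φ with
  | eqPos x y =>
    have h : (8 * Nat.pair x y) / 8 = Nat.pair x y := by omega
    rw [toCode, ofCode]; simp [h]
  | ltPos x y =>
    have h : (8 * Nat.pair x y + 1) / 8 = Nat.pair x y := by omega
    rw [toCode, ofCode]; simp [h, Nat.add_mod]
  | letter x a =>
    have h : (8 * Nat.pair x (Encodable.encode a) + 2) / 8 = Nat.pair x (Encodable.encode a) := by
      omega
    rw [toCode, ofCode]; simp [h, Nat.add_mod]
  | neg φ ih =>
    have h : (8 * φ.toCode + 3) / 8 = φ.toCode := by omega
    rw [toCode, ofCode]; simp [h, Nat.add_mod, ih]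
  | conj φ ψ ih1 ih2 =>
    have h : (8 * Nat.pair φ.toCode ψ.toCode + 4) / 8 = Nat.pair φ.toCode ψ.toCode := by omega
    rw [toCode, ofCode]; simp [h, Nat.add_mod, ih1, ih2]
  | disj φ ψ ih1 ih2 =>
    have h : (8 * Nat.pair φ.toCode ψ.toCode + 5) / 8 = Nat.pair φ.toCode ψ.toCode := by omega
    rw [toCode, ofCode]; simp [h, Nat.add_mod, ih1, ih2]
  | all x φ ih =>
    have h : (8 * Nat.pair x φ.toCode + 6) / 8 = Nat.pair x φ.toCode := by omega
    rw [toCode, ofCode]; simp [h, Nat.add_mod, ih]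
  | ex x φ ih =>
    have h : (8 * Nat.pair x φ.toCode + 7) / 8 = Nat.pair x φ.toCode := by omega
    rw [toCode, ofCode]; simp [h, Nat.add_mod, ih]

instance instEncodable [Encodable D] : Encodable (WordFormula D) where
  encode := toCode
  decode := ofCode
  encodek := ofCode_toCode

/-- One step of the course-of-values recursion that computes `(ofCode n).map toCode`, from the
list of the values at all smaller numbers. -/
def recodeStep (D : Type u) [Encodable D] (l : List (Option ℕ)) : Option ℕ :=
  if l.length % 8 = 0 then some l.length
  else if l.length % 8 = 1 then some l.length
  else if l.length % 8 = 2 then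
    ((Encodable.decode (α := D) (l.length / 8).unpair.2).map Encodable.encode).map fun k =>
      8 * Nat.pair (l.length / 8).unpair.1 k + 2
  else if l.length % 8 = 3 then (l[l.length / 8]?.bind id).map fun k => 8 * k + 3
  else if l.length % 8 = 4 then
    (l[(l.length / 8).unpair.1]?.bind id).bind fun p =>
      (l[(l.length / 8).unpair.2]?.bind id).map fun q => 8 * Nat.pair p q + 4
  else if l.length % 8 = 5 then
    (l[(l.length / 8).unpair.1]?.bind id).bind fun p =>
      (l[(l.length / 8).unpair.2]?.bind id).map fun q => 8 * Nat.pair p q + 5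
  else if l.length % 8 = 6 then
    (l[(l.length / 8).unpair.2]?.bind id).map fun q =>
      8 * Nat.pair (l.length / 8).unpair.1 q + 6
  else
    (l[(l.length / 8).unpair.2]?.bind id).map fun q =>
      8 * Nat.pair (l.length / 8).unpair.1 q + 7

theorem recodeStep_eq (D : Type u) [Encodable D] (n : ℕ) :
    recodeStep D ((List.range n).map fun k => (ofCode (D := D) k).map toCode) =
      (ofCode (D := D) n).map toCode := by
  have key : ∀ k < n, (((List.range n).map fun k => (ofCode (D := D) k).map toCode)[k]?.bind id) =
      (ofCode (D := D) k).map toCode := by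
    intro k hk
    simp [List.getElem?_range hk]
  have h1 := Nat.unpair_left_le (n / 8)
  have h2 := Nat.unpair_right_le (n / 8)
  have hn : ((List.range n).map fun k => (ofCode (D := D) k).map toCode).length = n := by simp
  have hp := Nat.pair_unpair (n / 8)
  have hl : n % 8 < 8 := Nat.mod_lt _ (by norm_num)
  rw [recodeStep, hn, ofCode]
  split_ifs with c0 c1 c2 c3 c4 c5 c6
  · simp only [Option.map_some, toCode, hp]; congr 1; omega
  · simp only [Option.map_some, toCode, hp]; congr 1; omega
  · simp only [Option.map_map]; rfl
  · rw [key _ (by omega)]; simp only [Option.map_map]; rfl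
  · rw [key _ (by omega), key _ (by omega)]
    cases ofCode (D := D) (n / 8).unpair.1 <;> cases ofCode (D := D) (n / 8).unpair.2 <;> rfl
  · rw [key _ (by omega), key _ (by omega)]
    cases ofCode (D := D) (n / 8).unpair.1 <;> cases ofCode (D := D) (n / 8).unpair.2 <;> rfl
  · rw [key _ (by omega)]; simp only [Option.map_map]; rfl
  · rw [key _ (by omega)]; simp only [Option.map_map]; rfl

theorem primrec_recodeStep (D : Type u) [Primcodable D] : Primrec (recodeStep D) := by
  have hn : Primrec fun l : List (Option ℕ) => l.length := Primrec.list_length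
  have hm : Primrec fun l : List (Option ℕ) => l.length / 8 :=
    Primrec.nat_div.comp hn (Primrec.const 8)
  have hr : Primrec fun l : List (Option ℕ) => l.length % 8 :=
    Primrec.nat_mod.comp hn (Primrec.const 8)
  have hu : Primrec fun l : List (Option ℕ) => (l.length / 8).unpair := Primrec.unpair.comp hm
  have hu1 := Primrec.fst.comp hu
  have hu2 := Primrec.snd.comp hu
  have hget : ∀ {f : List (Option ℕ) → ℕ}, Primrec f →
      Primrec fun l : List (Option ℕ) => l[f l]?.bind id := fun hf =>
    Primrec.option_bind (Primrec.list_getElem?.comp Primrec.id hf) Primrec.snd.to₂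
  have htag : ∀ c : ℕ, PrimrecPred fun l : List (Option ℕ) => l.length % 8 = c := fun c =>
    Primrec.eq.comp hr (Primrec.const c)
  have hlin : ∀ {α : Type} [Primcodable α] {f : α → ℕ} (c : ℕ), Primrec f →
      Primrec fun a => 8 * f a + c := fun c hf =>
    Primrec.nat_add.comp (Primrec.nat_mul.comp (Primrec.const 8) hf) (Primrec.const c)
  have hquant : ∀ {f : List (Option ℕ) → Option ℕ} (c : ℕ), Primrec f →
      Primrec fun l => (f l).map fun q => 8 * Nat.pair (l.length / 8).unpair.1 q + c :=
    fun c hf => Primrec.option_map hf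
      (hlin c (Primrec₂.natPair.comp (hu1.comp Primrec.fst) Primrec.snd)).to₂
  have hbin : ∀ c : ℕ, Primrec fun l : List (Option ℕ) =>
      (l[(l.length / 8).unpair.1]?.bind id).bind fun p =>
        (l[(l.length / 8).unpair.2]?.bind id).map fun q => 8 * Nat.pair p q + c := fun c =>
    Primrec.option_bind (hget hu1)
      (Primrec.option_map ((hget hu2).comp Primrec.fst)
        (hlin c (Primrec₂.natPair.comp (Primrec.snd.comp Primrec.fst) Primrec.snd)).to₂).to₂
  have hdec : Primrec fun l : List (Option ℕ) =>
      (Encodable.decode (α := D) (l.length / 8).unpair.2).map Encodable.encode :=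
    Primrec.option_map (Primrec.decode.comp hu2) (Primrec.encode.comp Primrec.snd).to₂
  unfold recodeStep
  exact Primrec.ite (htag 0) (Primrec.option_some.comp hn) <|
    Primrec.ite (htag 1) (Primrec.option_some.comp hn) <|
    Primrec.ite (htag 2) (hquant 2 hdec) <|
    Primrec.ite (htag 3) (Primrec.option_map (hget hm) (hlin 3 Primrec.snd).to₂) <|
    Primrec.ite (htag 4) (hbin 4) <|
    Primrec.ite (htag 5) (hbin 5) <|
    Primrec.ite (htag 6) (hquant 6 (hget hu2)) (hquant 7 (hget hu2))

/-- The numbering of formulas is effective if the numbering of the letters is. -/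
instance instPrimcodable [Primcodable D] : Primcodable (WordFormula D) where
  prim := by
    have h : Primrec₂ fun (_ : Unit) (n : ℕ) => (ofCode (D := D) n).map toCode :=
      Primrec.nat_strong_rec _
        (g := fun _ l => some (recodeStep D l))
        (Primrec.option_some.comp ((primrec_recodeStep D).comp Primrec.snd)).to₂
        (fun _ n => congrArg some (recodeStep_eq D n))
    have h' : Primrec fun n : ℕ => Encodable.encode ((ofCode (D := D) n).map toCode) :=
      Primrec.encode.comp (h.comp (Primrec.const ()) Primrec.id)
    refine (Primrec.nat_iff.1 h').of_eq fun n => ?_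
    change _ = Encodable.encode (ofCode (D := D) n)
    cases ofCode (D := D) n <;> rfl

end WordFormula

namespace WordFormula

variable {D : Type u}

/-! ### Free variables and codes -/

/-! The proof is a small-model argument in the style of Büchi and Elgot, followed by a bounded
search.

A word together with an assignment is read as a word whose positions are marked by the variables
they carry. By induction on the formula, its truth is decided by a deterministic automaton with
finitely many states: connectives are complements and products, and a quantifier is a subset
construction (`recognizedBy_holds`). Only the states need be finite, so the infinite alphabet does
no harm. The number of states is bounded by the primitive recursive function `stateBound` of the
code. After existential closure over the variables, pigeonhole on the states visited cuts any
nonempty model down to one of bounded length (`exists_short_model`).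

Letters that do not occur in the formula are indistinguishable to it, so all of them may be replaced
by one placeholder `none`. Conversely, since the alphabet is infinite, some letter has a number
beyond the code of the formula, hence does not occur in it, and can fill the placeholders
(`exists_candidate`, `satisfiable_of_candidate`). Thus finitely many candidate words suffice. The
empty word, which admits no assignment of positions, is tested separately (`satisfiable_iff`).

Evaluation on a candidate is primitive recursive: it is a fold over the formula whose values are
finite tables of satisfying assignments (`primrec_fold`, `primrec_evalList`). -/

theorem holds_congr (w : List D) (φ : WordFormula D) {v v' : ℕ → ℕ}
    (h : ∀ x ∈ φ.freeVars, v x = v' x) : φ.Holds w v ↔ φ.Holds w v' := by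
  induction φ generalizing v v' with
  | all x φ ih =>
    refine forall₂_congr fun i _ => ih fun y hy => ?_
    by_cases hxy : y = x
    · subst hxy; simp
    · simp [Function.update_of_ne hxy, h y (Finset.mem_erase.2 ⟨hxy, hy⟩)]
  | ex x φ ih =>
    refine exists_congr fun i => and_congr_right fun _ => ih fun y hy => ?_
    by_cases hxy : y = x
    · subst hxy; simp
    · simp [Function.update_of_ne hxy, h y (Finset.mem_erase.2 ⟨hxy, hy⟩)]
  | conj φ ψ ih1 ih2 =>
    exact and_congr (ih1 fun y hy => h y (Finset.mem_union_left _ hy))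
      (ih2 fun y hy => h y (Finset.mem_union_right _ hy))
  | disj φ ψ ih1 ih2 =>
    exact or_congr (ih1 fun y hy => h y (Finset.mem_union_left _ hy))
      (ih2 fun y hy => h y (Finset.mem_union_right _ hy))
  | neg φ ih => exact not_congr (ih h)
  | eqPos x y => simp only [Holds]; rw [h x (by simp [freeVars]), h y (by simp [freeVars])]
  | ltPos x y => simp only [Holds]; rw [h x (by simp [freeVars]), h y (by simp [freeVars])]
  | letter x a => simp only [Holds]; rw [h x (by simp [freeVars])]

/-- All variables and all letters of the formula have numbers less than `m`. -/
def Below [Encodable D] (m : ℕ) : WordFormula D → Prop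
  | all x φ => x < m ∧ φ.Below m
  | ex x φ => x < m ∧ φ.Below m
  | conj φ ψ => φ.Below m ∧ ψ.Below m
  | disj φ ψ => φ.Below m ∧ ψ.Below m
  | neg φ => φ.Below m
  | eqPos x y => x < m ∧ y < m
  | ltPos x y => x < m ∧ y < m
  | letter x a => x < m ∧ Encodable.encode a < m

/-- The pairing function dominates both arguments. The code therefore serves as a computable bound
on everything occurring in the formula: how many variables to close over, how long assignment lists
must be, and which letters matter. -/
theorem below_of_toCode_lt [Encodable D] {m : ℕ} (φ : WordFormula D) (h : φ.toCode < m) :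
    φ.Below m := by
  induction φ with
  | all x φ ih =>
    have h1 := Nat.left_le_pair x φ.toCode
    have h2 := Nat.right_le_pair x φ.toCode
    simp only [toCode] at h
    exact ⟨by omega, ih (by omega)⟩
  | ex x φ ih =>
    have h1 := Nat.left_le_pair x φ.toCode
    have h2 := Nat.right_le_pair x φ.toCode
    simp only [toCode] at h
    exact ⟨by omega, ih (by omega)⟩
  | conj φ ψ ih1 ih2 =>
    have h1 := Nat.left_le_pair φ.toCode ψ.toCode
    have h2 := Nat.right_le_pair φ.toCode ψ.toCode
    simp only [toCode] at h
    exact ⟨ih1 (by omega), ih2 (by omega)⟩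
  | disj φ ψ ih1 ih2 =>
    have h1 := Nat.left_le_pair φ.toCode ψ.toCode
    have h2 := Nat.right_le_pair φ.toCode ψ.toCode
    simp only [toCode] at h
    exact ⟨ih1 (by omega), ih2 (by omega)⟩
  | neg φ ih => simp only [toCode] at h; exact ih (by omega)
  | eqPos x y =>
    have h1 := Nat.left_le_pair x y
    have h2 := Nat.right_le_pair x y
    simp only [toCode] at h
    exact ⟨by omega, by omega⟩
  | ltPos x y =>
    have h1 := Nat.left_le_pair x y
    have h2 := Nat.right_le_pair x y
    simp only [toCode] at h
    exact ⟨by omega, by omega⟩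
  | letter x a =>
    have h1 := Nat.left_le_pair x (Encodable.encode a)
    have h2 := Nat.right_le_pair x (Encodable.encode a)
    simp only [toCode] at h
    exact ⟨by omega, by omega⟩

theorem Below.lt_of_mem_freeVars [Encodable D] {m : ℕ} {φ : WordFormula D} (h : φ.Below m) {x : ℕ}
    (hx : x ∈ φ.freeVars) : x < m := by
  induction φ with
  | all y φ ih => exact ih h.2 (Finset.mem_of_mem_erase hx)
  | ex y φ ih => exact ih h.2 (Finset.mem_of_mem_erase hx)
  | conj φ ψ ih1 ih2 => exact (Finset.mem_union.1 hx).elim (ih1 h.1) (ih2 h.2)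
  | disj φ ψ ih1 ih2 => exact (Finset.mem_union.1 hx).elim (ih1 h.1) (ih2 h.2)
  | neg φ ih => exact ih h hx
  | eqPos y z => rcases h with ⟨h1, h2⟩; simp [freeVars] at hx; omega
  | ltPos y z => rcases h with ⟨h1, h2⟩; simp [freeVars] at hx; omega
  | letter y a => rcases h with ⟨h1, h2⟩; simp [freeVars] at hx; omega

/-! ### Automata on words with marked positions -/

/-- A deterministic automaton reading a word together with, at each position, the set of variables
that are assigned to this position. -/
structure MarkAutomaton (D : Type u) where
  /-- The states. -/
  State : Type
  /-- The initial state. -/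
  start : State
  /-- The transition function. -/
  step : State → Option D → Set ℕ → State
  /-- The accepting states. -/
  accept : Set State

namespace MarkAutomaton

/-- The state after reading the first `k` positions of `w`, marked according to `v`. -/
def run (M : MarkAutomaton D) (w : List D) (v : ℕ → ℕ) : ℕ → M.State
  | 0 => M.start
  | k + 1 => M.step (M.run w v k) w[k]? {x | v x = k}

theorem run_congr (M : MarkAutomaton D) (w : List D) {v v' : ℕ → ℕ} {k : ℕ}
    (h : ∀ i < k, ∀ x, v x = i ↔ v' x = i) : M.run w v k = M.run w v' k := by
  induction k with
  | zero => rfl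
  | succ k ih =>
    have hk : {x | v x = k} = {x | v' x = k} := Set.ext fun x => h k (by omega) x
    simp only [run]
    rw [ih fun i hi => h i (by omega), hk]

/-- The automaton decides `P` on all assignments whose values are positions of the word. -/
def Decides (M : MarkAutomaton D) (P : List D → (ℕ → ℕ) → Prop) : Prop :=
  ∀ w v, (∀ x, v x < w.length) → (P w v ↔ M.run w v w.length ∈ M.accept)

/-- Product automaton. -/
def prod (M N : MarkAutomaton D) (acc : Set (M.State × N.State)) : MarkAutomaton D where
  State := M.State × N.State
  start := (M.start, N.start)
  step s a S := (M.step s.1 a S, N.step s.2 a S)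
  accept := acc

theorem run_prod (M N : MarkAutomaton D) (acc : Set (M.State × N.State)) (w : List D) (v : ℕ → ℕ)
    (k : ℕ) : (M.prod N acc).run w v k = (M.run w v k, N.run w v k) := by
  induction k with
  | zero => rfl
  | succ k ih => simp only [run, ih]; rfl

/-- The automaton that guesses the position of the variable `x`: it keeps track of the run in which
`x` has not been seen and of all runs in which it has. -/
def exists_ (M : MarkAutomaton D) (x : ℕ) : MarkAutomaton D where
  State := M.State × Set M.State
  start := (M.start, ∅)
  step s a S := (M.step s.1 a (S \ {x}),
    insert (M.step s.1 a (insert x S)) ((fun t => M.step t a (S \ {x})) '' s.2))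
  accept := {s | ∃ t ∈ s.2, t ∈ M.accept}

/-- Placing `x` at `n ≥ k` means that `x` has not been seen during the first `k` steps, which is
what the first component simulates. The second collects the runs for every earlier placement; at
each step the first component spawns the run that places `x` right there. -/
theorem run_exists (M : MarkAutomaton D) (x : ℕ) (w : List D) (v : ℕ → ℕ) (n k : ℕ) (hk : k ≤ n) :
    (M.exists_ x).run w v k = (M.run w (Function.update v x n) k,
      {t | ∃ i < k, t = M.run w (Function.update v x i) k}) := by
  have hdiff : ∀ j k, k ≠ j → {y | Function.update v x j y = k} = {y | v y = k} \ {x} := by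
    intro j k hjk
    ext y
    by_cases hy : y = x
    · subst hy; simp [hjk.symm]
    · simp [hy]
  have hins : ∀ k, {y | Function.update v x k y = k} = insert x {y | v y = k} := by
    intro k
    ext y
    by_cases hy : y = x
    · subst hy; simp
    · simp [hy]
  induction k with
  | zero => simp [run, exists_]
  | succ k ih =>
    -- Neither placement of `x` is visible among the first `k` positions.
    have hrun : M.run w (Function.update v x k) k = M.run w (Function.update v x n) k := by
      refine M.run_congr w fun i hi y => ?_
      by_cases hy : y = x
      · subst hy; simp only [Function.update_self]; omega
      · simp [Function.update_of_ne hy]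
    rw [run, ih (by omega)]
    refine Prod.ext ?_ ?_
    · simp only [exists_, run, hdiff n k (by omega)]
    · ext t
      simp only [exists_, run, Set.mem_insert_iff, Set.mem_image, Set.mem_ofPred_eq]
      constructor
      · rintro (rfl | ⟨_, ⟨i, hi, rfl⟩, rfl⟩)
        · exact ⟨k, by omega, by rw [hins, hrun]⟩
        · exact ⟨i, by omega, by rw [hdiff i k (by omega)]⟩
      · rintro ⟨i, hi, rfl⟩
        rcases Nat.lt_succ_iff_lt_or_eq.1 hi with hi | rfl
        · exact Or.inr ⟨_, ⟨i, hi, rfl⟩, by rw [hdiff i k (by omega)]⟩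
        · exact Or.inl (by rw [hins, hrun])

end MarkAutomaton

/-- `P` is decided by an automaton with at most `n` states. -/
def RecognizedBy (n : ℕ) (P : List D → (ℕ → ℕ) → Prop) : Prop :=
  ∃ M : MarkAutomaton D, Finite M.State ∧ Nat.card M.State ≤ n ∧ M.Decides P

namespace RecognizedBy

variable {n m : ℕ} {P Q : List D → (ℕ → ℕ) → Prop}

theorem mono (h : RecognizedBy n P) (hnm : n ≤ m) : RecognizedBy m P := by
  obtain ⟨M, hf, hc, hM⟩ := h
  exact ⟨M, hf, hc.trans hnm, hM⟩

theorem not (h : RecognizedBy n P) : RecognizedBy n fun w v => ¬ P w v := by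
  obtain ⟨M, hf, hc, hM⟩ := h
  refine ⟨{ M with accept := M.acceptᶜ }, hf, hc, fun w v hv => not_congr ?_⟩
  have hrun : ∀ k, ({ M with accept := M.acceptᶜ } : MarkAutomaton D).run w v k = M.run w v k := by
    intro k
    induction k with
    | zero => rfl
    | succ k ih => simp only [MarkAutomaton.run, ih]
  rw [hM w v hv, hrun]

/-- An arbitrary connective `f` costs nothing extra, since it only enters the accepting set. -/
theorem prod (hP : RecognizedBy n P) (hQ : RecognizedBy m Q) (f : Prop → Prop → Prop) :
    RecognizedBy (n * m) fun w v => f (P w v) (Q w v) := by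
  obtain ⟨M, hMf, hMc, hM⟩ := hP
  obtain ⟨N, hNf, hNc, hN⟩ := hQ
  refine ⟨M.prod N {s | f (s.1 ∈ M.accept) (s.2 ∈ N.accept)}, ?_, ?_, fun w v hv => ?_⟩
  · exact inferInstanceAs (Finite (M.State × N.State))
  · exact (Nat.card_prod M.State N.State).trans_le (Nat.mul_le_mul hMc hNc)
  · exact (iff_of_eq (congrArg₂ f (propext (hM w v hv)) (propext (hN w v hv)))).trans
      (iff_of_eq (congrArg (· ∈ {s : M.State × N.State | f (s.1 ∈ M.accept) (s.2 ∈ N.accept)})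
        (M.run_prod N _ w v w.length).symm))

theorem exists_ (hP : RecognizedBy n P) (x : ℕ) :
    RecognizedBy (n * 2 ^ n) fun w v => ∃ i < w.length, P w (Function.update v x i) := by
  obtain ⟨M, hf, hc, hM⟩ := hP
  refine ⟨M.exists_ x, ?_, ?_, fun w v hv => ?_⟩
  · exact inferInstanceAs (Finite (M.State × Set M.State))
  · have h : Nat.card (M.State × Set M.State) = Nat.card M.State * 2 ^ Nat.card M.State := by
      have := Fintype.ofFinite M.State
      classical
      simp [Nat.card_eq_fintype_card]
    exact h.trans_le (Nat.mul_le_mul hc (Nat.pow_le_pow_right (by norm_num) hc))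
  · rw [M.run_exists x w v w.length w.length le_rfl]
    have hup : ∀ i < w.length, ∀ y, Function.update v x i y < w.length := by
      intro i hi y
      by_cases hy : y = x
      · subst hy; simpa using hi
      · simpa [Function.update_of_ne hy] using hv y
    constructor
    · rintro ⟨i, hi, h⟩
      exact ⟨_, ⟨i, hi, rfl⟩, (hM w _ (hup i hi)).1 h⟩
    · rintro ⟨_, ⟨i, hi, rfl⟩, h⟩
      exact ⟨i, hi, (hM w _ (hup i hi)).2 h⟩

theorem forall_ (hP : RecognizedBy n P) (x : ℕ) :
    RecognizedBy (n * 2 ^ n) fun w v => ∀ i < w.length, P w (Function.update v x i) := by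
  have h := (hP.not.exists_ x).not
  simpa only [not_exists, not_and, not_not] using h

end RecognizedBy

open Classical in
-- One bit suffices: whether a suitable position has already been read.
theorem recognizedBy_atom (f : Option D → Set ℕ → Prop) :
    RecognizedBy 2 fun (w : List D) (v : ℕ → ℕ) => ∃ i < w.length, f w[i]? {x | v x = i} := by
  let M : MarkAutomaton D :=
    { State := Bool, start := false, step := fun s a S => s || decide (f a S), accept := {true} }
  refine ⟨M, inferInstanceAs (Finite Bool), (by simp [M]), fun w v _ => ?_⟩
  have hrun : ∀ k, M.run w v k = true ↔ ∃ i < k, f w[i]? {x | v x = i} := by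
    intro k
    induction k with
    | zero => simp [M, MarkAutomaton.run]
    | succ k ih =>
      have : M.run w v (k + 1) = (M.run w v k || decide (f w[k]? {x | v x = k}) : Bool) := rfl
      rw [this, Bool.or_eq_true, ih, decide_eq_true_iff]
      simp only [Nat.lt_succ_iff_lt_or_eq]
      grind
  exact (hrun w.length).symm

theorem recognizedBy_eqPos (x y : ℕ) :
    RecognizedBy 2 fun (_ : List D) (v : ℕ → ℕ) => v x = v y := by
  obtain ⟨M, hf, hc, hM⟩ := recognizedBy_atom (D := D) fun _ S => x ∈ S ∧ y ∈ S
  refine ⟨M, hf, hc, fun w v hv => Iff.trans ?_ (hM w v hv)⟩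
  constructor
  · intro h
    exact ⟨v x, hv x, rfl, h.symm⟩
  · rintro ⟨i, _, h1, h2⟩
    exact Eq.trans h1 (Eq.symm h2)

theorem recognizedBy_letter (x : ℕ) (a : D) :
    RecognizedBy 2 fun (w : List D) (v : ℕ → ℕ) => w[v x]? = some a := by
  obtain ⟨M, hf, hc, hM⟩ := recognizedBy_atom (D := D) fun b S => x ∈ S ∧ b = some a
  refine ⟨M, hf, hc, fun w v hv => Iff.trans ?_ (hM w v hv)⟩
  constructor
  · intro h
    exact ⟨v x, hv x, rfl, h⟩
  · rintro ⟨i, _, rfl, h⟩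
    exact h

open Classical in
theorem recognizedBy_ltPos (x y : ℕ) :
    RecognizedBy 4 fun (_ : List D) (v : ℕ → ℕ) => v x < v y := by
  let M : MarkAutomaton D :=
    { State := Bool × Bool
      start := (false, false)
      -- The first bit records that `x` was seen, the second that `y` came later. The second uses
      -- the old value of the first, so that equal positions do not count.
      step := fun s _ S => (s.1 || decide (x ∈ S), s.2 || (s.1 && decide (y ∈ S)))
      accept := {s | s.2 = true} }
  refine ⟨M, inferInstanceAs (Finite (Bool × Bool)), (by simp [M]), fun w v hv => ?_⟩
  have h1 : ∀ s a S, (M.step s a S).1 = true ↔ s.1 = true ∨ x ∈ S := by simp [M]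
  have h2 : ∀ s a S, (M.step s a S).2 = true ↔ s.2 = true ∨ (s.1 = true ∧ y ∈ S) := by simp [M]
  have hrun : ∀ k, ((M.run w v k).1 = true ↔ v x < k) ∧
      ((M.run w v k).2 = true ↔ v x < v y ∧ v y < k) := by
    intro k
    induction k with
    | zero => simp [M, MarkAutomaton.run]
    | succ k ih =>
      rw [MarkAutomaton.run, h1, h2, ih.1, ih.2]
      simp only [Set.mem_ofPred_eq]
      omega
  exact (and_iff_left (hv y)).symm.trans (hrun w.length).2.symm

/-! ### A bound on the length of a shortest model -/

/-- A bound on the number of states of an automaton for a formula with number at most `k`. -/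
def stateBound : ℕ → ℕ
  | 0 => 4
  | k + 1 => stateBound k * stateBound k * 2 ^ stateBound k

theorem stateBound_pos (k : ℕ) : 0 < stateBound k := by
  induction k with
  | zero => simp [stateBound]
  | succ k ih => simp only [stateBound]; positivity

theorem sq_le_stateBound_succ (k : ℕ) : stateBound k * stateBound k ≤ stateBound (k + 1) :=
  Nat.le_mul_of_pos_right _ (by positivity)

theorem mul_two_pow_le_stateBound_succ (k : ℕ) :
    stateBound k * 2 ^ stateBound k ≤ stateBound (k + 1) :=
  Nat.mul_le_mul_right _ (Nat.le_mul_of_pos_right _ (stateBound_pos k))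

theorem stateBound_mono : Monotone stateBound := by
  refine monotone_nat_of_le_succ fun k => le_trans ?_ (sq_le_stateBound_succ k)
  exact Nat.le_mul_of_pos_right _ (stateBound_pos k)

theorem four_le_stateBound (k : ℕ) : 4 ≤ stateBound k := stateBound_mono (Nat.zero_le k)

/-- One step of `stateBound` covers both the product and the subset construction, and passing from
subformulas to the formula raises the code by at least one. -/
theorem recognizedBy_holds [Encodable D] (φ : WordFormula D) :
    RecognizedBy (stateBound φ.toCode) fun w v => φ.Holds w v := by
  induction φ with
  | all x φ ih =>
    refine (ih.forall_ x).mono ((mul_two_pow_le_stateBound_succ _).trans (stateBound_mono ?_))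
    have := Nat.right_le_pair x φ.toCode
    simp only [toCode]; omega
  | ex x φ ih =>
    refine (ih.exists_ x).mono ((mul_two_pow_le_stateBound_succ _).trans (stateBound_mono ?_))
    have := Nat.right_le_pair x φ.toCode
    simp only [toCode]; omega
  | conj φ ψ ih1 ih2 =>
    have h1 := Nat.left_le_pair φ.toCode ψ.toCode
    have h2 := Nat.right_le_pair φ.toCode ψ.toCode
    refine (((ih1.mono (stateBound_mono h1)).prod (ih2.mono (stateBound_mono h2)) And).mono
      ((sq_le_stateBound_succ _).trans (stateBound_mono ?_)))
    simp only [toCode]; omega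
  | disj φ ψ ih1 ih2 =>
    have h1 := Nat.left_le_pair φ.toCode ψ.toCode
    have h2 := Nat.right_le_pair φ.toCode ψ.toCode
    refine (((ih1.mono (stateBound_mono h1)).prod (ih2.mono (stateBound_mono h2)) Or).mono
      ((sq_le_stateBound_succ _).trans (stateBound_mono ?_)))
    simp only [toCode]; omega
  | neg φ ih =>
    refine ih.not.mono (stateBound_mono ?_)
    simp only [toCode]; omega
  | eqPos x y => exact (recognizedBy_eqPos x y).mono (le_trans (by norm_num) (four_le_stateBound _))
  | ltPos x y => exact (recognizedBy_ltPos x y).mono (four_le_stateBound _)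
  | letter x a =>
    exact (recognizedBy_letter x a).mono (le_trans (by norm_num) (four_le_stateBound _))

/-- Existential quantification over the variables `0, …, m - 1`. -/
def exClosure (P : List D → (ℕ → ℕ) → Prop) : ℕ → List D → (ℕ → ℕ) → Prop
  | 0 => P
  | m + 1 => fun w v => ∃ i < w.length, exClosure P m w (Function.update v m i)

/-- Each of the `m` quantifiers is paid for by one step of `stateBound`. -/
theorem recognizedBy_exClosure {P : List D → (ℕ → ℕ) → Prop} {k : ℕ}
    (h : RecognizedBy (stateBound k) P) (m : ℕ) :
    RecognizedBy (stateBound (k + m)) (exClosure P m) := by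
  induction m with
  | zero => exact h
  | succ m ih => exact (ih.exists_ m).mono (mul_two_pow_le_stateBound_succ _)

theorem exClosure_of {P : List D → (ℕ → ℕ) → Prop} {w : List D} {v' : ℕ → ℕ}
    (hv' : ∀ x, v' x < w.length) (h : P w v') (m : ℕ) (v : ℕ → ℕ) (hv : ∀ x, m ≤ x → v x = v' x) :
    exClosure P m w v := by
  induction m generalizing v with
  | zero => rwa [exClosure, funext fun x => hv x (Nat.zero_le x)]
  | succ m ih =>
    refine ⟨v' m, hv' m, ih _ fun x hx => ?_⟩
    by_cases hxm : x = m
    · subst hxm; simp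
    · simpa [Function.update_of_ne hxm] using hv x (by omega)

theorem exists_of_exClosure {P : List D → (ℕ → ℕ) → Prop} {w : List D} (m : ℕ) {v : ℕ → ℕ}
    (hv : ∀ x, v x < w.length) (h : exClosure P m w v) :
    ∃ v', (∀ x, v' x < w.length) ∧ P w v' := by
  induction m generalizing v with
  | zero => exact ⟨v, hv, h⟩
  | succ m ih =>
    obtain ⟨i, hi, h⟩ := h
    refine ih (fun x => ?_) h
    by_cases hxm : x = m
    · subst hxm; simpa using hi
    · simpa [Function.update_of_ne hxm] using hv x

/-- Cutting out a loop of the run. All marks sit at position 0, which survives because `0 < j`; the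
positions shifted by the cut carry no marks, so the rest of the run is unchanged. -/
theorem MarkAutomaton.run_take_append_drop (M : MarkAutomaton D) (w : List D) {j k : ℕ}
    (hj : 0 < j) (hjk : j ≤ k) (hk : k ≤ w.length)
    (h : M.run w (fun _ => 0) j = M.run w (fun _ => 0) k) (i : ℕ) :
    M.run (w.take j ++ w.drop k) (fun _ => 0) (j + i) = M.run w (fun _ => 0) (k + i) := by
  induction i with
  | zero =>
    have hpre : ∀ l ≤ j, M.run (w.take j ++ w.drop k) (fun _ => 0) l = M.run w (fun _ => 0) l := by
      intro l hl
      induction l with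
      | zero => rfl
      | succ l ih =>
        have hl' : (w.take j ++ w.drop k)[l]? = w[l]? := by
          rw [List.getElem?_append_left (by simp; omega), List.getElem?_take_of_lt (by omega)]
        rw [run, run, ih (by omega), hl']
    exact (hpre j le_rfl).trans h
  | succ i ih =>
    have hi : (w.take j ++ w.drop k)[j + i]? = w[k + i]? := by
      rw [List.getElem?_append_right (by simp), List.getElem?_drop]
      congr 1
      simp; omega
    have hm : {x : ℕ | 0 = j + i} = {x : ℕ | 0 = k + i} := by
      ext; simp; omega
    rw [← Nat.add_assoc, ← Nat.add_assoc, run, run, ih, hi, hm]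

/-- A recognized property that holds of a nonempty word, with all variables at its first position,
holds of a short one. -/
theorem RecognizedBy.exists_short {n : ℕ} {P : List D → (ℕ → ℕ) → Prop} (hP : RecognizedBy n P)
    {w : List D} (hw : 0 < w.length) (h : P w fun _ => 0) :
    ∃ w' : List D, 0 < w'.length ∧ w'.length ≤ n ∧ P w' fun _ => 0 := by
  obtain ⟨M, hf, hc, hM⟩ := hP
  induction hl : w.length using Nat.strong_induction_on generalizing w with
  | _ l ih =>
    by_cases hn : l ≤ n
    · exact ⟨w, hw, hl.trans_le hn, h⟩
    have := Fintype.ofFinite M.State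
    -- Only the `l` nonempty prefixes are compared, hence the shift by one: the first position must
    -- remain, and `l > n` still forces a repetition.
    obtain ⟨a, b, hab, heq⟩ := Fintype.exists_ne_map_eq_of_card_lt
      (fun i : Fin l => M.run w (fun _ => 0) (i + 1))
      (by rw [Fintype.card_fin, ← Nat.card_eq_fintype_card]; omega)
    wlog hlt : a < b generalizing a b
    · exact this b a hab.symm heq.symm (lt_of_le_of_ne (not_lt.1 hlt) hab.symm)
    have ha := a.2
    have hb := b.2
    have hlt' : (a : ℕ) < b := hlt
    have hlen : (w.take (a + 1) ++ w.drop (b + 1)).length = a + 1 + (l - (b + 1)) := by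
      simp; omega
    have hrun := M.run_take_append_drop w (j := a + 1) (k := b + 1) (by omega) (by omega) (by omega)
      heq (l - (b + 1))
    refine ih _ (by omega) (w := w.take (a + 1) ++ w.drop (b + 1)) (by omega) ?_ hlen
    refine (hM _ _ fun _ => by omega).2 ?_
    rw [hlen, hrun]
    have : (b : ℕ) + 1 + (l - (b + 1)) = w.length := by omega
    rw [this]
    exact (hM _ _ fun _ => hw).1 h

/-- A formula that holds in a nonempty word holds in a short one. -/
theorem exists_short_model [Encodable D] (φ : WordFormula D) {w : List D} {v : ℕ → ℕ}
    (hw : 0 < w.length) (hv : ∀ x ∈ φ.freeVars, v x < w.length) (h : φ.Holds w v) :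
    ∃ (w' : List D) (v' : ℕ → ℕ), w'.length ≤ stateBound (φ.toCode + (φ.toCode + 1)) ∧
      (∀ x, v' x < w'.length) ∧ φ.Holds w' v' := by
  have hB := φ.below_of_toCode_lt (Nat.lt_succ_self φ.toCode)
  -- `Decides` speaks only of assignments sending every variable to a position, so the irrelevant
  -- variables are moved to position 0.
  let v₀ : ℕ → ℕ := fun x => if x ∈ φ.freeVars then v x else 0
  have hv₀ : ∀ x, v₀ x < w.length := by
    intro x
    by_cases hx : x ∈ φ.freeVars
    · simpa [v₀, hx] using hv x hx
    · simpa [v₀, hx] using hw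
  have h₀ : φ.Holds w v₀ := (holds_congr w φ fun x hx => by simp [v₀, hx]).1 h
  have hcl := exClosure_of (P := fun w v => φ.Holds w v) hv₀ h₀ (φ.toCode + 1) (fun _ => 0)
    fun x hx => by
      have : x ∉ φ.freeVars := fun hx' => by have := hB.lt_of_mem_freeVars hx'; omega
      simp [v₀, this]
  obtain ⟨w', hw', hlen, h'⟩ :=
    (recognizedBy_exClosure (recognizedBy_holds φ) (φ.toCode + 1)).exists_short hw hcl
  obtain ⟨v', hv', h'⟩ := exists_of_exClosure (φ.toCode + 1) (fun _ => hw') h'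
  exact ⟨w', v', hlen, hv', h'⟩

/-! ### Primitive recursion on formulas -/

section Fold

variable {σ : Type*}

/-- Structural recursion on formulas. -/
def fold (fall fex : ℕ → σ → σ) (fconj fdisj : σ → σ → σ) (fneg : σ → σ) (feq flt : ℕ → ℕ → σ)
    (flet : ℕ → D → σ) : WordFormula D → σ
  | all x φ => fall x (fold fall fex fconj fdisj fneg feq flt flet φ)
  | ex x φ => fex x (fold fall fex fconj fdisj fneg feq flt flet φ)
  | conj φ ψ => fconj (fold fall fex fconj fdisj fneg feq flt flet φ)
      (fold fall fex fconj fdisj fneg feq flt flet ψ)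
  | disj φ ψ => fdisj (fold fall fex fconj fdisj fneg feq flt flet φ)
      (fold fall fex fconj fdisj fneg feq flt flet ψ)
  | neg φ => fneg (fold fall fex fconj fdisj fneg feq flt flet φ)
  | eqPos x y => feq x y
  | ltPos x y => flt x y
  | letter x a => flet x a

/-- One step of the course-of-values recursion that computes `fold` on the formula with a given
number. -/
def foldStep [Encodable D] (fall fex : ℕ → σ → σ) (fconj fdisj : σ → σ → σ) (fneg : σ → σ)
    (feq flt : ℕ → ℕ → σ) (flet : ℕ → D → σ) (l : List (Option σ)) : Option σ :=
  if l.length % 8 = 0 then some (feq (l.length / 8).unpair.1 (l.length / 8).unpair.2)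
  else if l.length % 8 = 1 then some (flt (l.length / 8).unpair.1 (l.length / 8).unpair.2)
  else if l.length % 8 = 2 then
    (Encodable.decode (α := D) (l.length / 8).unpair.2).map fun a => flet (l.length / 8).unpair.1 a
  else if l.length % 8 = 3 then (l[l.length / 8]?.bind id).map fneg
  else if l.length % 8 = 4 then
    (l[(l.length / 8).unpair.1]?.bind id).bind fun p =>
      (l[(l.length / 8).unpair.2]?.bind id).map fun q => fconj p q
  else if l.length % 8 = 5 then
    (l[(l.length / 8).unpair.1]?.bind id).bind fun p =>
      (l[(l.length / 8).unpair.2]?.bind id).map fun q => fdisj p q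
  else if l.length % 8 = 6 then
    (l[(l.length / 8).unpair.2]?.bind id).map fun q => fall (l.length / 8).unpair.1 q
  else
    (l[(l.length / 8).unpair.2]?.bind id).map fun q => fex (l.length / 8).unpair.1 q

theorem foldStep_eq [Encodable D] (fall fex : ℕ → σ → σ) (fconj fdisj : σ → σ → σ) (fneg : σ → σ)
    (feq flt : ℕ → ℕ → σ) (flet : ℕ → D → σ) (n : ℕ) :
    foldStep fall fex fconj fdisj fneg feq flt flet ((List.range n).map fun k =>
      (ofCode (D := D) k).map (fold fall fex fconj fdisj fneg feq flt flet)) =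
      (ofCode (D := D) n).map (fold fall fex fconj fdisj fneg feq flt flet) := by
  set F : WordFormula D → σ := fold fall fex fconj fdisj fneg feq flt flet with hF
  have key : ∀ k < n, (((List.range n).map fun k => (ofCode (D := D) k).map F)[k]?.bind id) =
      (ofCode (D := D) k).map F := by
    intro k hk
    simp [List.getElem?_range hk]
  have h1 := Nat.unpair_left_le (n / 8)
  have h2 := Nat.unpair_right_le (n / 8)
  have hn : ((List.range n).map fun k => (ofCode (D := D) k).map F).length = n := by simp
  have hl : n % 8 < 8 := Nat.mod_lt _ (by norm_num)
  rw [foldStep, hn, ofCode]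
  split_ifs with c0 c1 c2 c3 c4 c5 c6
  · rfl
  · rfl
  · simp only [Option.map_map]; rfl
  · rw [key _ (by omega)]; simp only [Option.map_map]; rfl
  · rw [key _ (by omega), key _ (by omega)]
    cases ofCode (D := D) (n / 8).unpair.1 <;> cases ofCode (D := D) (n / 8).unpair.2 <;> rfl
  · rw [key _ (by omega), key _ (by omega)]
    cases ofCode (D := D) (n / 8).unpair.1 <;> cases ofCode (D := D) (n / 8).unpair.2 <;> rfl
  · rw [key _ (by omega)]; simp only [Option.map_map]; rfl
  · rw [key _ (by omega)]; simp only [Option.map_map]; rfl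

/-- Course-of-values recursion on codes: subformulas have smaller codes, so their values are already
in the list. The parameter in `α` carries the data shared by all steps, such as the word under
evaluation. -/
theorem primrec_fold {α : Type*} [Primcodable α] [Primcodable σ] [Primcodable D]
    {fall fex : α → ℕ → σ → σ} {fconj fdisj : α → σ → σ → σ} {fneg : α → σ → σ}
    {feq flt : α → ℕ → ℕ → σ} {flet : α → ℕ → D → σ}
    (hall : Primrec fun p : α × ℕ × σ => fall p.1 p.2.1 p.2.2)
    (hex : Primrec fun p : α × ℕ × σ => fex p.1 p.2.1 p.2.2)
    (hconj : Primrec fun p : α × σ × σ => fconj p.1 p.2.1 p.2.2)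
    (hdisj : Primrec fun p : α × σ × σ => fdisj p.1 p.2.1 p.2.2)
    (hneg : Primrec fun p : α × σ => fneg p.1 p.2)
    (heq : Primrec fun p : α × ℕ × ℕ => feq p.1 p.2.1 p.2.2)
    (hlt : Primrec fun p : α × ℕ × ℕ => flt p.1 p.2.1 p.2.2)
    (hlet : Primrec fun p : α × ℕ × D => flet p.1 p.2.1 p.2.2) :
    Primrec₂ fun (a : α) (φ : WordFormula D) =>
      φ.fold (fall a) (fex a) (fconj a) (fdisj a) (fneg a) (feq a) (flt a) (flet a) := by
  have hn : Primrec fun p : α × List (Option σ) => p.2.length :=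
    Primrec.list_length.comp Primrec.snd
  have hm : Primrec fun p : α × List (Option σ) => p.2.length / 8 :=
    Primrec.nat_div.comp hn (Primrec.const 8)
  have hr : Primrec fun p : α × List (Option σ) => p.2.length % 8 :=
    Primrec.nat_mod.comp hn (Primrec.const 8)
  have hu : Primrec fun p : α × List (Option σ) => (p.2.length / 8).unpair := Primrec.unpair.comp hm
  have hu1 := Primrec.fst.comp hu
  have hu2 := Primrec.snd.comp hu
  have hget : ∀ {f : α × List (Option σ) → ℕ}, Primrec f →
      Primrec fun p : α × List (Option σ) => p.2[f p]?.bind id := fun hf =>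
    Primrec.option_bind (Primrec.list_getElem?.comp Primrec.snd hf) Primrec.snd.to₂
  have htag : ∀ c : ℕ, PrimrecPred fun p : α × List (Option σ) => p.2.length % 8 = c := fun c =>
    Primrec.eq.comp hr (Primrec.const c)
  have hquant : ∀ {f : α → ℕ → σ → σ}, (Primrec fun p : α × ℕ × σ => f p.1 p.2.1 p.2.2) →
      Primrec fun p : α × List (Option σ) => (p.2[(p.2.length / 8).unpair.2]?.bind id).map
        fun q => f p.1 (p.2.length / 8).unpair.1 q :=
    fun hf => Primrec.option_map (hget hu2)
      (hf.comp ((Primrec.fst.comp Primrec.fst).pair ((hu1.comp Primrec.fst).pair Primrec.snd))).to₂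
  have hbin : ∀ {f : α → σ → σ → σ}, (Primrec fun p : α × σ × σ => f p.1 p.2.1 p.2.2) →
      Primrec fun p : α × List (Option σ) => (p.2[(p.2.length / 8).unpair.1]?.bind id).bind
        fun q => (p.2[(p.2.length / 8).unpair.2]?.bind id).map fun r => f p.1 q r := fun hf =>
    Primrec.option_bind (hget hu1) (Primrec.option_map ((hget hu2).comp Primrec.fst)
      (hf.comp ((Primrec.fst.comp (Primrec.fst.comp Primrec.fst)).pair
        ((Primrec.snd.comp Primrec.fst).pair Primrec.snd))).to₂).to₂
  have hatom : ∀ {f : α → ℕ → ℕ → σ}, (Primrec fun p : α × ℕ × ℕ => f p.1 p.2.1 p.2.2) →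
      Primrec fun p : α × List (Option σ) =>
        some (f p.1 (p.2.length / 8).unpair.1 (p.2.length / 8).unpair.2) := fun hf =>
    Primrec.option_some.comp (hf.comp (Primrec.fst.pair (hu1.pair hu2)))
  have hstep : Primrec fun p : α × List (Option σ) => foldStep (fall p.1) (fex p.1) (fconj p.1)
      (fdisj p.1) (fneg p.1) (feq p.1) (flt p.1) (flet p.1) p.2 := by
    unfold foldStep
    exact Primrec.ite (htag 0) (hatom heq) <|
      Primrec.ite (htag 1) (hatom hlt) <|
      Primrec.ite (htag 2) (Primrec.option_map (Primrec.decode.comp hu2)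
        (hlet.comp ((Primrec.fst.comp Primrec.fst).pair
          ((hu1.comp Primrec.fst).pair Primrec.snd))).to₂) <|
      Primrec.ite (htag 3) (Primrec.option_map (hget hm)
        (hneg.comp ((Primrec.fst.comp Primrec.fst).pair Primrec.snd)).to₂) <|
      Primrec.ite (htag 4) (hbin hconj) <|
      Primrec.ite (htag 5) (hbin hdisj) <|
      Primrec.ite (htag 6) (hquant hall) (hquant hex)
  have hrec := Primrec.nat_strong_rec
    (fun (a : α) (n : ℕ) => (ofCode (D := D) n).map
      (fold (fall a) (fex a) (fconj a) (fdisj a) (fneg a) (feq a) (flt a) (flet a)))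
    (g := fun a l => some (foldStep (fall a) (fex a) (fconj a) (fdisj a) (fneg a) (feq a) (flt a)
      (flet a) l))
    (Primrec.option_some.comp hstep).to₂
    (fun a n => congrArg some (foldStep_eq _ _ _ _ _ _ _ _ n))
  refine Primrec₂.option_some_iff.1
    ((hrec.comp Primrec.fst (Primrec.encode.comp Primrec.snd)).to₂.of_eq fun a φ => ?_)
  change (ofCode φ.toCode).map _ = _
  rw [ofCode_toCode]; rfl

end Fold

/-! ### Evaluation of formulas -/

section Eval

/-- A list of the free variables of a formula. -/
def freeVarList : WordFormula D → List ℕ :=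
  fold (fun x l => l.filter (· ≠ x)) (fun x l => l.filter (· ≠ x)) (· ++ ·) (· ++ ·) id
    (fun x y => [x, y]) (fun x y => [x, y]) fun x _ => [x]

theorem mem_freeVarList (φ : WordFormula D) (y : ℕ) : y ∈ φ.freeVarList ↔ y ∈ φ.freeVars := by
  induction φ with
  | all x φ ih =>
    have : (all x φ).freeVarList = φ.freeVarList.filter (· ≠ x) := rfl
    simp [this, freeVars, ih, and_comm]
  | ex x φ ih =>
    have : (ex x φ).freeVarList = φ.freeVarList.filter (· ≠ x) := rfl
    simp [this, freeVars, ih, and_comm]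
  | conj φ ψ ih1 ih2 =>
    have : (conj φ ψ).freeVarList = φ.freeVarList ++ ψ.freeVarList := rfl
    simp [this, freeVars, ih1, ih2]
  | disj φ ψ ih1 ih2 =>
    have : (disj φ ψ).freeVarList = φ.freeVarList ++ ψ.freeVarList := rfl
    simp [this, freeVars, ih1, ih2]
  | neg φ ih => exact ih
  | eqPos x z =>
    have : (eqPos x z : WordFormula D).freeVarList = [x, z] := rfl
    simp [this, freeVars]
  | ltPos x z =>
    have : (ltPos x z : WordFormula D).freeVarList = [x, z] := rfl
    simp [this, freeVars]
  | letter x a =>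
    have : (letter x a).freeVarList = [x] := rfl
    simp [this, freeVars]

open Classical in
/-- The entries of a list that satisfy a predicate. -/
noncomputable def sep {β : Type*} (A : List β) (p : β → Prop) : List β := A.filter fun b => p b

theorem mem_sep {β : Type*} {A : List β} {p : β → Prop} {b : β} :
    b ∈ sep A p ↔ b ∈ A ∧ p b := by
  simp [sep]

/-- The assignments in `A` that make the formula true in `w`, an assignment being given by the list
of its values. The entry `none` of `w` stands for a letter that does not occur in the formula. -/
noncomputable def evalList (w : List (Option D)) (A : List (List ℕ)) :
    WordFormula D → List (List ℕ) :=
  fold (fun x T => sep A fun v => ∀ i < w.length, v.set x i ∈ T)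
    (fun x T => sep A fun v => ∃ i < w.length, v.set x i ∈ T)
    (fun T U => sep A fun v => v ∈ T ∧ v ∈ U)
    (fun T U => sep A fun v => v ∈ T ∨ v ∈ U)
    (fun T => sep A fun v => v ∉ T)
    (fun x y => sep A fun v => v.getD x 0 = v.getD y 0)
    (fun x y => sep A fun v => v.getD x 0 < v.getD y 0)
    fun x a => sep A fun v => w[v.getD x 0]? = some (some a)

theorem evalList_subset (w : List (Option D)) (A : List (List ℕ)) (φ : WordFormula D) :
    φ.evalList w A ⊆ A := by
  cases φ <;> exact fun v hv => (mem_sep.1 hv).1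

/-- `hA` makes the table closed under the updates performed by quantifiers, and its lists long
enough for every variable; it is vacuous for the empty word. `hw` asks for agreement only on letters
that can occur in the formula. -/
theorem mem_evalList [Encodable D] {w : List D} {w' : List (Option D)} {A : List (List ℕ)} {m : ℕ}
    (hlen : w'.length = w.length)
    (hw : ∀ (i : ℕ) (a : D), Encodable.encode a < m → (w'[i]? = some (some a) ↔ w[i]? = some a))
    (hA : ∀ v ∈ A, ∀ i < w.length, ∀ x < m, x < v.length ∧ v.set x i ∈ A)
    (φ : WordFormula D) (hφ : φ.Below m) {v : List ℕ} (hv : v ∈ A) :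
    v ∈ φ.evalList w' A ↔ φ.Holds w fun x => v.getD x 0 := by
  have hset : ∀ v ∈ A, ∀ i < w.length, ∀ x < m,
      (fun y => (v.set x i).getD y 0) = Function.update (fun y => v.getD y 0) x i := by
    intro v hv i hi x hx
    have hx' := (hA v hv i hi x hx).1
    ext y
    by_cases hy : y = x
    · subst hy; simp [List.getD_eq_getElem?_getD, hx']
    · simp [List.getD_eq_getElem?_getD, Function.update_of_ne hy, List.getElem?_set_ne (Ne.symm hy)]
  induction φ generalizing v with
  | all x φ ih =>
    have h : v ∈ (all x φ).evalList w' A ↔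
        v ∈ A ∧ ∀ i < w'.length, v.set x i ∈ φ.evalList w' A := by
      simp only [evalList, fold, mem_sep]
    rw [h, and_iff_right hv, hlen]
    refine forall₂_congr fun i hi => ?_
    exact (ih hφ.2 (hA v hv i hi x hφ.1).2).trans (by rw [hset v hv i hi x hφ.1])
  | ex x φ ih =>
    have h : v ∈ (ex x φ).evalList w' A ↔
        v ∈ A ∧ ∃ i < w'.length, v.set x i ∈ φ.evalList w' A := by
      simp only [evalList, fold, mem_sep]
    rw [h, and_iff_right hv, hlen]
    refine exists_congr fun i => and_congr_right fun hi => ?_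
    exact (ih hφ.2 (hA v hv i hi x hφ.1).2).trans (by rw [hset v hv i hi x hφ.1])
  | conj φ ψ ih1 ih2 =>
    have h : v ∈ (conj φ ψ).evalList w' A ↔
        v ∈ A ∧ (v ∈ φ.evalList w' A ∧ v ∈ ψ.evalList w' A) := by
      simp only [evalList, fold, mem_sep]
    exact (h.trans (and_iff_right hv)).trans (and_congr (ih1 hφ.1 hv) (ih2 hφ.2 hv))
  | disj φ ψ ih1 ih2 =>
    have h : v ∈ (disj φ ψ).evalList w' A ↔
        v ∈ A ∧ (v ∈ φ.evalList w' A ∨ v ∈ ψ.evalList w' A) := by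
      simp only [evalList, fold, mem_sep]
    exact (h.trans (and_iff_right hv)).trans (or_congr (ih1 hφ.1 hv) (ih2 hφ.2 hv))
  | neg φ ih =>
    have h : v ∈ (neg φ).evalList w' A ↔ v ∈ A ∧ v ∉ φ.evalList w' A := by
      simp only [evalList, fold, mem_sep]
    exact (h.trans (and_iff_right hv)).trans (not_congr (ih hφ hv))
  | eqPos x y => simp only [evalList, fold, mem_sep, hv, true_and, Holds]
  | ltPos x y => simp only [evalList, fold, mem_sep, hv, true_and, Holds]
  | letter x a =>
    simp only [evalList, fold, mem_sep, hv, true_and, Holds]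
    exact hw _ a hφ.2

end Eval

/-- All lists of length `n` with entries from `L`. -/
def listsOfLength {β : Type*} (L : List β) : ℕ → List (List β)
  | 0 => [[]]
  | n + 1 => L.flatMap fun a => (listsOfLength L n).map (a :: ·)

theorem mem_listsOfLength {β : Type*} {L : List β} {n : ℕ} {v : List β} :
    v ∈ listsOfLength L n ↔ v.length = n ∧ ∀ a ∈ v, a ∈ L := by
  induction n generalizing v with
  | zero => simp +contextual [listsOfLength]
  | succ n ih => cases v <;> simp [listsOfLength, ih]; tauto

/-! ### Primitive recursiveness of the evaluation -/

section Primrec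

variable {α β : Type*} [Primcodable α] [Primcodable β]

theorem primrec_sep {f : α → List β} {R : α → β → Prop} (hf : Primrec f) (hR : PrimrecRel R) :
    Primrec fun a => sep (f a) (R a) := by
  classical
  have h := PrimrecRel.listFilter (R := fun (b : β) (a : α) => R a b)
    (hR.comp Primrec.snd Primrec.fst)
  exact (h.comp hf Primrec.id).of_eq fun a => by simp only [sep, id]

theorem primrecPred_exists_mem {f : α → List β} {R : α → β → Prop} (hf : Primrec f)
    (hR : PrimrecRel R) : PrimrecPred fun a => ∃ b ∈ f a, R a b :=
  (PrimrecRel.exists_mem_list (R := fun (b : β) (a : α) => R a b)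
    (hR.comp Primrec.snd Primrec.fst)).comp hf Primrec.id

theorem primrecPred_forall_mem {f : α → List β} {R : α → β → Prop} (hf : Primrec f)
    (hR : PrimrecRel R) : PrimrecPred fun a => ∀ b ∈ f a, R a b :=
  (PrimrecRel.forall_mem_list (R := fun (b : β) (a : α) => R a b)
    (hR.comp Primrec.snd Primrec.fst)).comp hf Primrec.id

theorem primrecPred_mem {f : α → List β} {g : α → β} (hf : Primrec f) (hg : Primrec g) :
    PrimrecPred fun a => g a ∈ f a := by
  classical
  exact (primrecPred_exists_mem (R := fun a b => b = g a) hf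
    (Primrec.eq.comp Primrec.snd (hg.comp Primrec.fst))).of_eq fun a => by simp

theorem primrec_freeVarList [Primcodable D] : Primrec (freeVarList (D := D)) := by
  have hq : Primrec fun p : Unit × ℕ × List ℕ => p.2.2.filter (· ≠ p.2.1) :=
    (primrec_sep (R := fun (p : Unit × ℕ × List ℕ) y => y ≠ p.2.1)
      (Primrec.snd.comp Primrec.snd)
      (Primrec.eq.comp Primrec.snd (Primrec.fst.comp (Primrec.snd.comp Primrec.fst))).not).of_eq fun p => by
        simp only [sep]; congr!
  have hb : Primrec fun p : Unit × List ℕ × List ℕ => p.2.1 ++ p.2.2 :=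
    Primrec.list_append.comp (Primrec.fst.comp Primrec.snd) (Primrec.snd.comp Primrec.snd)
  have ha : Primrec fun p : Unit × ℕ × ℕ => [p.2.1, p.2.2] :=
    Primrec.list_cons.comp (Primrec.fst.comp Primrec.snd)
      (Primrec.list_cons.comp (Primrec.snd.comp Primrec.snd) (Primrec.const []))
  have hl : Primrec fun p : Unit × ℕ × D => [p.2.1] :=
    Primrec.list_cons.comp (Primrec.fst.comp Primrec.snd) (Primrec.const [])
  exact (primrec_fold (fall := fun _ x l => l.filter (· ≠ x))
    (fex := fun _ x l => l.filter (· ≠ x)) (fconj := fun _ => (· ++ ·))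
    (fdisj := fun _ => (· ++ ·)) (fneg := fun _ => id) (feq := fun _ x y => [x, y])
    (flt := fun _ x y => [x, y]) (flet := fun _ x _ => [x]) hq hq hb hb Primrec.snd ha ha hl).comp
    (Primrec.const ()) Primrec.id

theorem primrecPred_set_mem {α : Type*} [Primcodable α] {v : α → List ℕ} {x i : α → ℕ}
    {T : α → List (List ℕ)} (hv : Primrec v) (hx : Primrec x) (hi : Primrec i) (hT : Primrec T) :
    PrimrecPred fun a => (v a).set (x a) (i a) ∈ T a :=
  primrecPred_mem hT (Primrec.list_set.comp hv (hx.pair hi))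

theorem primrecPred_forall_set_mem {α : Type*} [Primcodable α] {n : α → ℕ} {v : α → List ℕ}
    {x : α → ℕ} {T : α → List (List ℕ)} (hn : Primrec n) (hv : Primrec v) (hx : Primrec x)
    (hT : Primrec T) : PrimrecPred fun a => ∀ i < n a, (v a).set (x a) i ∈ T a :=
  (primrecPred_forall_mem (R := fun a i => (v a).set (x a) i ∈ T a) (Primrec.list_range.comp hn)
    (primrecPred_set_mem (hv.comp Primrec.fst) (hx.comp Primrec.fst) Primrec.snd
      (hT.comp Primrec.fst))).of_eq fun a => by simp

theorem primrecPred_exists_set_mem {α : Type*} [Primcodable α] {n : α → ℕ} {v : α → List ℕ}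
    {x : α → ℕ} {T : α → List (List ℕ)} (hn : Primrec n) (hv : Primrec v) (hx : Primrec x)
    (hT : Primrec T) : PrimrecPred fun a => ∃ i < n a, (v a).set (x a) i ∈ T a :=
  (primrecPred_exists_mem (R := fun a i => (v a).set (x a) i ∈ T a) (Primrec.list_range.comp hn)
    (primrecPred_set_mem (hv.comp Primrec.fst) (hx.comp Primrec.fst) Primrec.snd
      (hT.comp Primrec.fst))).of_eq fun a => by simp

theorem primrec_evalList [Primcodable D] :
    Primrec₂ fun (p : List (Option D) × List (List ℕ)) (φ : WordFormula D) =>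
      φ.evalList p.1 p.2 := by
  classical
  have hA : ∀ {γ : Type} [Primcodable γ],
      Primrec fun p : (List (Option D) × List (List ℕ)) × γ => p.1.2 := fun {γ} _ =>
    Primrec.snd.comp Primrec.fst
  have hall : PrimrecRel fun (p : (List (Option D) × List (List ℕ)) × ℕ × List (List ℕ))
      (v : List ℕ) => ∀ i < p.1.1.length, v.set p.2.1 i ∈ p.2.2 :=
    primrecPred_forall_set_mem
      (Primrec.list_length.comp (Primrec.fst.comp (Primrec.fst.comp Primrec.fst))) Primrec.snd
      (Primrec.fst.comp (Primrec.snd.comp Primrec.fst))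
      (Primrec.snd.comp (Primrec.snd.comp Primrec.fst))
  have hex : PrimrecRel fun (p : (List (Option D) × List (List ℕ)) × ℕ × List (List ℕ))
      (v : List ℕ) => ∃ i < p.1.1.length, v.set p.2.1 i ∈ p.2.2 :=
    primrecPred_exists_set_mem
      (Primrec.list_length.comp (Primrec.fst.comp (Primrec.fst.comp Primrec.fst))) Primrec.snd
      (Primrec.fst.comp (Primrec.snd.comp Primrec.fst))
      (Primrec.snd.comp (Primrec.snd.comp Primrec.fst))
  have h1 : PrimrecRel fun (p : (List (Option D) × List (List ℕ)) × List (List ℕ) × List (List ℕ))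
      (v : List ℕ) => v ∈ p.2.1 :=
    primrecPred_mem (Primrec.fst.comp (Primrec.snd.comp Primrec.fst)) Primrec.snd
  have h2 : PrimrecRel fun (p : (List (Option D) × List (List ℕ)) × List (List ℕ) × List (List ℕ))
      (v : List ℕ) => v ∈ p.2.2 :=
    primrecPred_mem (Primrec.snd.comp (Primrec.snd.comp Primrec.fst)) Primrec.snd
  have hneg : PrimrecRel fun (p : (List (Option D) × List (List ℕ)) × List (List ℕ))
      (v : List ℕ) => v ∉ p.2 :=
    (primrecPred_mem (Primrec.snd.comp Primrec.fst) Primrec.snd).not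
  have hx : Primrec fun q : ((List (Option D) × List (List ℕ)) × ℕ × ℕ) × List ℕ =>
      q.2.getD q.1.2.1 0 :=
    (Primrec.list_getD 0).comp Primrec.snd (Primrec.fst.comp (Primrec.snd.comp Primrec.fst))
  have hy : Primrec fun q : ((List (Option D) × List (List ℕ)) × ℕ × ℕ) × List ℕ =>
      q.2.getD q.1.2.2 0 :=
    (Primrec.list_getD 0).comp Primrec.snd (Primrec.snd.comp (Primrec.snd.comp Primrec.fst))
  have hletter : PrimrecRel fun (p : (List (Option D) × List (List ℕ)) × ℕ × D) (v : List ℕ) =>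
      p.1.1[v.getD p.2.1 0]? = some (some p.2.2) :=
    Primrec.eq.comp
      (Primrec.list_getElem?.comp (Primrec.fst.comp (Primrec.fst.comp Primrec.fst))
        ((Primrec.list_getD 0).comp Primrec.snd (Primrec.fst.comp (Primrec.snd.comp Primrec.fst))))
      (Primrec.option_some.comp (Primrec.option_some.comp
        (Primrec.snd.comp (Primrec.snd.comp Primrec.fst))))
  have hA' : Primrec fun p : (List (Option D) × List (List ℕ)) × ℕ × D => p.1.2 :=
    Primrec.snd.comp Primrec.fst
  exact primrec_fold (primrec_sep hA hall) (primrec_sep hA hex) (primrec_sep hA (h1.and h2))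
    (primrec_sep hA (h1.or h2)) (primrec_sep hA hneg) (primrec_sep hA (Primrec.eq.comp hx hy))
    (primrec_sep hA (Primrec.nat_lt.comp hx hy)) (primrec_sep hA' hletter)

theorem primrec_stateBound : Primrec stateBound := by
  have hpow : Primrec₂ fun a b : ℕ => a ^ b :=
    Primrec₂.unpaired'.1 Nat.Primrec.pow
  have hstep : Primrec₂ fun (_ b : ℕ) => b * b * 2 ^ b :=
    Primrec.nat_mul.comp (Primrec.nat_mul.comp Primrec.snd Primrec.snd)
      (hpow.comp (Primrec.const 2) Primrec.snd)
  refine (Primrec.nat_rec₁ 4 hstep).of_eq fun n => ?_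
  induction n with
  | zero => rfl
  | succ n ih => simp only [stateBound, ← ih]

theorem primrec_listsOfLength : Primrec₂ (listsOfLength (β := β)) := by
  refine (Primrec.nat_rec (f := fun _ : List β => [[]])
    (g := fun L p => L.flatMap fun a => p.2.map (a :: ·)) (Primrec.const _) ?_).of_eq fun L n => ?_
  · exact Primrec.list_flatMap Primrec.fst (Primrec.list_map
      (Primrec.snd.comp (Primrec.snd.comp Primrec.fst))
      (Primrec.list_cons.comp (Primrec.snd.comp Primrec.fst) Primrec.snd).to₂).to₂
  · induction n with
    | zero => rfl
    | succ n ih => simp only [listsOfLength, ← ih]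

end Primrec

/-! ### Decidability of satisfiability -/

section Decide

variable [Primcodable D]

/-- The words in which it suffices to look for a model of `φ`. -/
def candidateWords (φ : WordFormula D) : List (List (Option D)) :=
  (List.range (stateBound (φ.toCode + (φ.toCode + 1)) + 1)).flatMap
    (listsOfLength (none :: (List.range (φ.toCode + 1)).map Encodable.decode))

theorem primrec_candidateWords : Primrec (candidateWords (D := D)) := by
  have he : Primrec fun φ : WordFormula D => φ.toCode := Primrec.encode
  have hs : Primrec fun φ : WordFormula D => φ.toCode + 1 := Primrec.succ.comp he
  refine Primrec.list_flatMap (Primrec.list_range.comp (Primrec.succ.comp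
    (primrec_stateBound.comp (Primrec.nat_add.comp he hs)))) ?_
  exact primrec_listsOfLength.comp (Primrec.list_cons.comp (Primrec.const none)
    (Primrec.list_map (Primrec.list_range.comp (hs.comp Primrec.fst))
      (Primrec.decode.comp Primrec.snd).to₂)) Primrec.snd

/-- The lists of values of the assignments of positions below `n` to the variables below `m`. -/
def assignments (n m : ℕ) : List (List ℕ) := listsOfLength (List.range n) m

theorem mem_evalList_assignments {w : List D} {w' : List (Option D)} (φ : WordFormula D)
    (hlen : w'.length = w.length)
    (hw : ∀ (i : ℕ) (a : D), Encodable.encode a < φ.toCode + 1 → (w'[i]? = some (some a) ↔ w[i]? = some a))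
    {v : List ℕ} (hv : v ∈ assignments w.length (φ.toCode + 1)) :
    v ∈ φ.evalList w' (assignments w.length (φ.toCode + 1)) ↔
      φ.Holds w fun x => v.getD x 0 := by
  refine mem_evalList hlen hw (fun v hv i hi x hx => ?_) φ
    (φ.below_of_toCode_lt (Nat.lt_succ_self _)) hv
  obtain ⟨h1, h2⟩ := mem_listsOfLength.1 hv
  refine ⟨by omega, mem_listsOfLength.2 ⟨by simpa using h1, fun a ha => ?_⟩⟩
  rcases List.mem_or_eq_of_mem_set ha with ha | rfl
  · exact h2 a ha
  · simpa using hi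

theorem satisfiable_of_candidate [Infinite D] (φ : WordFormula D) {w' : List (Option D)}
    (h : φ.evalList w' (assignments w'.length (φ.toCode + 1)) ≠ []) : φ.Satisfiable := by
  obtain ⟨v, hv⟩ := List.exists_mem_of_ne_nil _ h
  have hvA := evalList_subset _ _ _ hv
  -- The only use of the infinite alphabet: a letter too large to occur in the formula, put in place
  -- of `none`.
  obtain ⟨d, hd⟩ : ∃ d : D, φ.toCode < Encodable.encode d := by
    by_contra! hd
    exact Set.infinite_univ.mono (t := {d : D | Encodable.encode d ≤ φ.toCode})
      (fun d _ => hd d) ((Set.finite_Iic φ.toCode).preimage Encodable.encode_injective.injOn)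
  have hlen : w'.length = (w'.map (·.getD d)).length := by simp
  rw [hlen] at hv hvA
  refine ⟨w'.map (·.getD d), fun x => v.getD x 0, fun x hx => ?_,
    (mem_evalList_assignments φ hlen (fun i a ha => ?_) hvA).1 hv⟩
  · have hx' := (φ.below_of_toCode_lt (Nat.lt_succ_self _)).lt_of_mem_freeVars hx
    change v.getD x 0 < _
    obtain ⟨h1, h2⟩ := mem_listsOfLength.1 hvA
    have hxv : x < v.length := by omega
    rw [List.getD_eq_getElem _ _ hxv]
    exact List.mem_range.1 (h2 _ (List.getElem_mem hxv))
  · have had : d ≠ a := by rintro rfl; omega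
    rw [List.getElem?_map]
    rcases w'[i]? with _ | _ | b <;> simp [had]

theorem exists_candidate (φ : WordFormula D) {w : List D} {v : ℕ → ℕ}
    (hlen : w.length ≤ stateBound (φ.toCode + (φ.toCode + 1))) (hv : ∀ x, v x < w.length)
    (h : φ.Holds w v) :
    ∃ w' ∈ φ.candidateWords, φ.evalList w' (assignments w'.length (φ.toCode + 1)) ≠ [] := by
  -- Letters too large to occur in the formula are erased.
  let g : D → Option D := fun d => if Encodable.encode d ≤ φ.toCode then some d else none
  have hg : (w.map g).length = w.length := by simp
  refine ⟨w.map g, ?_, ?_⟩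
  · refine List.mem_flatMap.2 ⟨w.length, List.mem_range.2 (by omega),
      mem_listsOfLength.2 ⟨by simp, fun a ha => ?_⟩⟩
    obtain ⟨d, -, rfl⟩ := List.mem_map.1 ha
    by_cases hd : Encodable.encode d ≤ φ.toCode
    · simp only [g, hd, if_true]
      exact List.mem_cons_of_mem _ (List.mem_map.2
        ⟨Encodable.encode d, List.mem_range.2 (by omega), Encodable.encodek d⟩)
    · simp [g, hd]
  · rw [hg]
    have hvA : (List.range (φ.toCode + 1)).map v ∈ assignments w.length (φ.toCode + 1) :=
      mem_listsOfLength.2 ⟨by simp, fun a ha => by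
        obtain ⟨x, -, rfl⟩ := List.mem_map.1 ha
        exact List.mem_range.2 (hv x)⟩
    refine List.ne_nil_of_mem ((mem_evalList_assignments φ hg (fun i a ha => ?_) hvA).2
      ((holds_congr w φ fun x hx => ?_).1 h))
    · rw [List.getElem?_map]
      rcases w[i]? with _ | b
      · simp
      · by_cases hb : Encodable.encode b ≤ φ.toCode
        · simp [g, hb]
        · have : b ≠ a := by rintro rfl; omega
          simp [g, hb, this]
    · have hx' := (φ.below_of_toCode_lt (Nat.lt_succ_self _)).lt_of_mem_freeVars hx
      simp [List.getD_eq_getElem?_getD, List.getElem?_range hx']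

/-- The left disjunct is the empty model, possible only without free variables. The empty candidate
contributes nothing on the right: assignment lists have positive length, and there are no positions
to fill them. -/
theorem satisfiable_iff [Infinite D] (φ : WordFormula D) :
    φ.Satisfiable ↔ (φ.freeVarList = [] ∧ [] ∈ φ.evalList [] [[]]) ∨
      ∃ w ∈ φ.candidateWords, φ.evalList w (assignments w.length (φ.toCode + 1)) ≠ [] := by
  have hfree : φ.freeVarList = [] ↔ ∀ x, x ∉ φ.freeVars := by
    simp [List.eq_nil_iff_forall_not_mem, mem_freeVarList]
  have hnil : [] ∈ φ.evalList [] [[]] ↔ φ.Holds [] fun x => ([] : List ℕ).getD x 0 :=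
    mem_evalList rfl (by simp) (by simp) φ (φ.below_of_toCode_lt (Nat.lt_succ_self _)) (by simp)
  constructor
  · rintro ⟨w, v, hv, h⟩
    rcases w.length.eq_zero_or_pos with hw | hw
    · obtain rfl := List.length_eq_zero_iff.1 hw
      have hf : ∀ x, x ∉ φ.freeVars := fun x hx => absurd (hv x hx) (by simp)
      exact Or.inl ⟨hfree.2 hf, hnil.2 ((holds_congr [] φ fun x hx => absurd hx (hf x)).1 h)⟩
    · obtain ⟨w', v', hlen, hv', h'⟩ := φ.exists_short_model hw hv h
      exact Or.inr (φ.exists_candidate hlen hv' h')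
  · rintro (⟨hf, h⟩ | ⟨w, -, h⟩)
    · exact ⟨[], _, fun x hx => absurd hx (hfree.1 hf x), hnil.1 h⟩
    · exact φ.satisfiable_of_candidate h

theorem primrecPred_satisfiable [Infinite D] :
    PrimrecPred fun φ : WordFormula D => φ.Satisfiable := by
  classical
  have hnil : PrimrecPred fun φ : WordFormula D => [] ∈ φ.evalList [] [[]] :=
    primrecPred_mem (primrec_evalList.comp (Primrec.const ([], [[]])) Primrec.id)
      (Primrec.const [])
  have hfree : PrimrecPred fun φ : WordFormula D => φ.freeVarList = [] :=
    Primrec.eq.comp primrec_freeVarList (Primrec.const [])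
  have hassign : Primrec fun p : WordFormula D × List (Option D) =>
      assignments p.2.length (p.1.toCode + 1) :=
    primrec_listsOfLength.comp
      (Primrec.list_range.comp (Primrec.list_length.comp Primrec.snd))
      (Primrec.succ.comp (Primrec.encode.comp Primrec.fst))
  have hcand : PrimrecRel fun (φ : WordFormula D) (w : List (Option D)) =>
      φ.evalList w (assignments w.length (φ.toCode + 1)) ≠ [] :=
    (Primrec.eq.comp (primrec_evalList.comp (Primrec.snd.pair hassign) Primrec.fst)
      (Primrec.const [])).not
  exact ((hfree.and hnil).or (primrecPred_exists_mem primrec_candidateWords hcand)).of_eq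
    fun φ => (satisfiable_iff φ).symm

end Decide

end WordFormula

/-- Over any infinite alphabet `D` with an effective numbering of its letters, the satisfiability
(non-emptiness) of first-order formulas on finite words over `D` is decidable. -/
theorem mainTheorem4 (D : Type u) [Infinite D] [Primcodable D] :
    ComputablePred (fun φ : WordFormula D => φ.Satisfiable) :=
  WordFormula.primrecPred_satisfiable.computablePred
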